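/- Let $r\ge 0$ be an integer. There exists a constant $c_r\ge 1$ depending only on $r$ such that the following holds. Let $X_1,\dots,X_n$ be i.i.d. random variables, defined on a probability space $(\Omega,\mathcal A,\mathbb P)$, with values in a measurable space $(S,\mathcal S)$ and common distribution $P$; let $p\ge 1$ be an integer, $q\in[1,\infty)$, and let $\psi_1,\dots,\psi_p\in L^q(P^r)$ be non-negative, symmetric, $\mathcal S^{\otimes r}$-measurable functions $S^r\to\mathbb R$ (constants if $r=0$). Then $$\Big\|\max_{1\le j\le p}J_r(\psi_j)\Big\|_{L^q(\mathbb P)}\le c_r\max_{0\le s\le r}n^{r-s}(q+\log p)^s\Big\|\max_{1\le j\le p}M(P^{r-s}\psi_j)\Big\|_{L^q(\mathbb P)}.$$ Here $J_r(\psi):=\sum_{1\le i_1<\dots<i_r\le n}\psi(X_{i_1},\dots,X_{i_r})$ (so $J_0(\psi)=\psi$); for $0\le s\le r$, $P^{r-s}\psi(x_1,\dots,x_s):=\int\psi(x_1,\dots,x_s,y_{s+1},\dots,y_r)\,P(dy_{s+1})\cdots P(dy_r)$, which is finite for $P^s$-almost every $(x_1,\dots,x_s)$ and is set to $0$ elsewhere;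 and for $f:S^s\to\mathbb R$, $M(f):=\max|f(X_{i_1},\dots,X_{i_s})|$, the maximum being over all $s$-tuples of pairwise distinct indices in $\{1,\dots,n\}$, with $\max\emptyset:=0$. -/

import Mathlib

open MeasureTheory ProbabilityTheory
open scoped ENNReal

noncomputable section

/-- A function on `S^r` is symmetric if it is invariant under permutations of its arguments. -/
def IsSymmetricKernel {S : Type*} {r : ℕ} (ψ : (Fin r → S) → ℝ) : Prop :=
  ∀ (σ : Equiv.Perm (Fin r)) (x : Fin r → S), ψ (fun k => x (σ k)) = ψ x

open Classical in
/-- The (unaveraged) `U`-statistic `J_r(ψ) = ∑_{i_1 < ⋯ < i_r} ψ(x_{i_1}, …, x_{i_r})` of the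
sample `x = (x_1, …, x_n)`. For `r = 0` the only index tuple is the empty one, so `J_0(ψ) = ψ`. -/
def uStat {S : Type*} {n r : ℕ} (ψ : (Fin r → S) → ℝ) (x : Fin n → S) : ℝ :=
  ∑ i ∈ Finset.univ.filter (fun i : Fin r → Fin n => StrictMono i), ψ (fun k => x (i k))

/-- `M(f) = max |f(x_{i_1}, …, x_{i_r})|` over all tuples of pairwise distinct indices; the
maximum of the empty family (`n < r`) is `0`. -/
def maxKernel {S : Type*} {n r : ℕ} (f : (Fin r → S) → ℝ) (x : Fin n → S) : ℝ :=
  ⨆ i : Fin r ↪ Fin n, |f (fun k => x (i k))|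

/-- The function `P^{r-s}ψ : S^s → ℝ` (for `s ≤ r`),
`P^{r-s}ψ(x_1, …, x_s) = E[ψ(x_1, …, x_s, Y_{s+1}, …, Y_r)]`, where `(Y_1, …, Y_r)` has the law
`P^r` (`P` is a probability measure, so integrating over the unused `Y_1, …, Y_s` is harmless). -/
def projKernel {S : Type*} [MeasurableSpace S] (P : Measure S) {r : ℕ} (s : ℕ)
    (ψ : (Fin r → S) → ℝ) (x : Fin s → S) : ℝ :=
  ∫ y : Fin r → S, ψ (fun k => if h : (k : ℕ) < s then x ⟨k, h⟩ else y k)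
    ∂(Measure.pi fun _ : Fin r => P)

end

/-!
The proof runs on the product space `S^n` with the law `P^n`. For one kernel `ψ` put `J = J_r(ψ)`
and, for a set `U` of sample indices, let `D_U` (`projEnvelope`) be
`ε + ∑_{s ≤ r} n^{r-s} L^s sup P^{r-s}ψ(x_{i_1}, …, x_{i_s})` over distinct indices in `U`, with
`L = q + log p`; write `D` for the case of all indices. Up to the factor `r + 1` and the limit
`ε → 0`, the maximum over `j` of `D` is what the theorem has on its right-hand side.

If a weight `G ≥ 0` depends only on the points in `U` and `|U| ≤ κ L`, then
`∫ G J ≤ κ^r ∫ G D_U`: a summand of `J` with `s` arguments in `U` may have its other arguments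
integrated out, and there are at most `|U|^s n^{r-s}` such summands (`lintegral_mul_uStat_le`).
Since `D_U ≤ D`, a factor `J / D` is at most `J / D_U`; expanding `J` into its summands and
absorbing `ψ(x_{i_1}, …, x_{i_r}) / D_U` into the weight enlarges `U` by at most `r` indices, and so
the step can be repeated about `L` times. The outcome is the self-normalised bound
`∫ J^b D^θ (J / D)^m ≤ K^m ∫ J^b D^θ` for `b + m` of the order of `L`, with `K` depending only on
`r` (`lintegral_mul_pow_mul_rpow_mul_div_pow_le`).

Now let `q = b + θ` with `b = ⌊q⌋`. Pointwise `J^q ≤ (A D)^q + A^{1-m} J^b D^θ (J / D)^m`, so the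
second term integrates to at most `A (K / A)^m ∫ (J^q + D^q)`. For `A` large in terms of `K`, and
`m` of the order of `L ≥ log p`, the factor `A (K / A)^m` is below `1 / (4 p)`. The second terms can
therefore be summed over the `p` kernels, which replaces the maximum over `j`, and the resulting
quarter of `∫ max_j J_j^q < ∞` is absorbed into the left-hand side
(`lintegral_iSup_uStat_rpow_le`).
-/

/-! ### Coordinate maps and product measures -/

theorem measurePreserving_comp_injective {S ι κ : Type*} [MeasurableSpace S] [Fintype ι]
    [Fintype κ] (P : Measure S) [IsProbabilityMeasure P] {e : ι → κ} (he : e.Injective) :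
    MeasurePreserving (fun (x : κ → S) (i : ι) => x (e i))
      (Measure.pi fun _ : κ => P) (Measure.pi fun _ : ι => P) := by
  have hind : iIndepFun (fun (k : κ) (x : κ → S) => x k) (Measure.pi fun _ : κ => P) :=
    iIndepFun_pi (μ := fun _ : κ => P) (X := fun _ => id) fun _ => aemeasurable_id
  refine ⟨by fun_prop, ?_⟩
  rw [(iIndepFun_iff_map_fun_eq_pi_map fun i => (measurable_pi_apply (e i)).aemeasurable).1
    (hind.precomp he)]
  congr 1
  ext1 i
  exact (measurePreserving_eval (fun _ : κ => P) (e i)).map_eq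

/-- Reading a point of `S^ι` off a pair in `S^κ × S^κ'`, along an injection of index sets. -/
theorem measurePreserving_sumElim_comp {S ι κ κ' : Type*} [MeasurableSpace S] [Fintype ι]
    [Fintype κ] [Fintype κ'] (P : Measure S) [IsProbabilityMeasure P] {e : ι → κ ⊕ κ'}
    (he : e.Injective) :
    MeasurePreserving (fun (z : (κ → S) × (κ' → S)) (i : ι) => Sum.elim z.1 z.2 (e i))
      ((Measure.pi fun _ : κ => P).prod (Measure.pi fun _ : κ' => P))
      (Measure.pi fun _ : ι => P) := by
  have h := (measurePreserving_comp_injective P he).comp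
    (measurePreserving_sumPiEquivProdPi_symm (X := fun _ : κ ⊕ κ' => S) (fun _ => P))
  convert h using 1
  ext z i
  simp only [Function.comp]
  rcases e i with a | a <;> rfl

/-! ### Splitting the index tuples along a set of sample points -/

open Classical in
/-- The injective index tuples whose first `s` entries, and no others, lie in `U`. -/
noncomputable def splitTuples {n : ℕ} (r s : ℕ) (U : Finset (Fin n)) : Finset (Fin r → Fin n) :=
  Finset.univ.filter fun t => t.Injective ∧ ∀ k, t k ∈ U ↔ (k : ℕ) < s

theorem card_splitTuples_le {n r s : ℕ} (hs : s ≤ r) (U : Finset (Fin n)) :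
    (splitTuples r s U).card ≤ U.card ^ s * n ^ (r - s) := by
  classical
  have hsub : splitTuples r s U ⊆
      Fintype.piFinset fun k : Fin r => if (k : ℕ) < s then U else Finset.univ := by
    intro t ht
    simp only [splitTuples, Finset.mem_filter, Finset.mem_univ, true_and] at ht
    refine Fintype.mem_piFinset.2 fun k => ?_
    split_ifs with hk
    · exact (ht.2 k).2 hk
    · exact Finset.mem_univ _
  refine (Finset.card_le_card hsub).trans_eq ?_
  rw [Fintype.card_piFinset]
  have h1 : ∀ k : Fin r, (if (k : ℕ) < s then U else (Finset.univ : Finset (Fin n))).card =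
      if (k : ℕ) < s then U.card else n := by
    intro k
    split_ifs <;> simp
  simp only [h1]
  rw [Fin.prod_univ_eq_prod_range (fun k => if k < s then U.card else n) r,
    ← Finset.prod_range_mul_prod_Ico _ hs,
    Finset.prod_congr rfl (g := fun _ => U.card)
      (fun k hk => if_pos (Finset.mem_range.1 hk)),
    Finset.prod_congr rfl (g := fun _ => n)
      (fun k hk => if_neg (Finset.mem_Ico.1 hk).1.not_gt)]
  simp

/-- Every index tuple can be reordered so that its entries in `U` come first. -/
theorem exists_perm_mem_iff_lt {n r : ℕ} (i : Fin r → Fin n) (U : Finset (Fin n)) :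
    ∃ s ≤ r, ∃ σ : Equiv.Perm (Fin r), ∀ k, i (σ k) ∈ U ↔ (k : ℕ) < s := by
  classical
  have hle : Fintype.card {k : Fin r // i k ∈ U} ≤ r := by
    simpa using Fintype.card_subtype_le fun k : Fin r => i k ∈ U
  refine ⟨Fintype.card {k : Fin r // i k ∈ U}, hle, ?_⟩
  have hcard : Fintype.card {k : Fin r // (k : ℕ) < Fintype.card {k : Fin r // i k ∈ U}} =
      Fintype.card {k : Fin r // i k ∈ U} := by
    rw [Fintype.card_subtype]
    generalize Fintype.card {k : Fin r // i k ∈ U} = s at hle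
    rw [Fin.card_filter_val_lt, min_eq_right hle]
  let e := Fintype.equivOfCardEq hcard
  exact ⟨e.extendSubtype, fun k => ⟨fun h => by_contra fun hk =>
    e.extendSubtype_not_mem k hk h, fun h => e.extendSubtype_mem k h⟩⟩

theorem ofReal_uStat {S : Type*} {n r : ℕ} {ψ : (Fin r → S) → ℝ} (h0 : ∀ x, 0 ≤ ψ x)
    (x : Fin n → S) :
    ENNReal.ofReal (uStat ψ x) = ∑ i with StrictMono (α := Fin r) (β := Fin n) i,
      ENNReal.ofReal (ψ fun k => x (i k)) := by
  classical
  rw [uStat, ENNReal.ofReal_sum_of_nonneg fun i _ => h0 _]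

/-- Sorting the summands of `J_r(ψ)` by the number of their arguments that carry an index in `U`.
Symmetry of `ψ` allows these arguments to be moved to the front. -/
theorem ofReal_uStat_le_sum_splitTuples {S : Type*} {n r : ℕ} {ψ : (Fin r → S) → ℝ}
    (h0 : ∀ x, 0 ≤ ψ x) (hsym : IsSymmetricKernel ψ) (U : Finset (Fin n)) (x : Fin n → S) :
    ENNReal.ofReal (uStat ψ x) ≤ ∑ s ∈ Finset.range (r + 1), ∑ t ∈ splitTuples r s U,
      ENNReal.ofReal (ψ fun k => x (t k)) := by
  classical
  rw [ofReal_uStat h0, Finset.sum_sigma']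
  choose s hs σ hσ using fun i : Fin r → Fin n => exists_perm_mem_iff_lt i U
  have hinj : Set.InjOn
      (fun i : Fin r → Fin n => (⟨s i, fun k => i (σ i k)⟩ : (_ : ℕ) × (Fin r → Fin n)))
      (Finset.univ.filter fun i : Fin r → Fin n => StrictMono i) := by
    intro i hi j hj hij
    have hij' : (i ∘ σ i) = (j ∘ σ j) := eq_of_heq (Sigma.mk.inj hij).2
    simp only [Finset.coe_filter, Finset.mem_univ, true_and, Set.mem_ofPred_eq] at hi hj
    -- a strictly monotone tuple is determined by its range
    refine (hi.range_inj hj).1 ?_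
    rw [← (σ i).surjective.range_comp i, hij', (σ j).surjective.range_comp j]
  calc ∑ i with StrictMono (α := Fin r) (β := Fin n) i, ENNReal.ofReal (ψ fun k => x (i k))
      = ∑ i with StrictMono (α := Fin r) (β := Fin n) i,
          ENNReal.ofReal (ψ fun k => x (i (σ i k))) :=
        Finset.sum_congr rfl fun i _ => by rw [← hsym (σ i) fun k => x (i k)]
    _ = ∑ a ∈ (Finset.univ.filter fun i : Fin r → Fin n => StrictMono i).image
          (fun i => (⟨s i, fun k => i (σ i k)⟩ : (_ : ℕ) × (Fin r → Fin n))),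
          ENNReal.ofReal (ψ fun k => x (a.2 k)) := by
        rw [Finset.sum_image hinj]
    _ ≤ _ := by
        refine Finset.sum_le_sum_of_subset fun a ha => ?_
        obtain ⟨i, hi, rfl⟩ := Finset.mem_image.1 ha
        simp only [Finset.mem_filter, Finset.mem_univ, true_and] at hi
        simp only [splitTuples, Finset.mem_sigma, Finset.mem_range, Finset.mem_filter,
          Finset.mem_univ, true_and]
        exact ⟨Nat.lt_succ_of_le (hs i), hi.injective.comp (σ i).injective, hσ i⟩

/-! ### Integrating out the arguments outside a set of sample points -/

section Projection

variable {S : Type*} [MeasurableSpace S] {P : Measure S} {n r : ℕ}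
  {ψ : (Fin r → S) → ℝ}

theorem measurable_projKernel (P : Measure S) [IsProbabilityMeasure P] (hψ : Measurable ψ)
    (s : ℕ) : Measurable (projKernel P s ψ) := by
  have h : Measurable fun z : (Fin s → S) × (Fin r → S) =>
      ψ fun k => if h : (k : ℕ) < s then z.1 ⟨k, h⟩ else z.2 k := by
    refine hψ.comp (measurable_pi_lambda _ fun k => ?_)
    split_ifs <;> fun_prop
  exact h.stronglyMeasurable.integral_prod_right.measurable

/-- Fubini: off a null set the Bochner integral defining `projKernel` is a genuine one. -/
theorem lintegral_le_ofReal_projKernel [IsProbabilityMeasure P] (hint : Integrable ψ (Measure.pi fun _ => P))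
    (h0 : ∀ x, 0 ≤ ψ x) (s : ℕ) :
    ∀ᵐ z ∂(Measure.pi fun _ : Fin s => P),
      ∫⁻ y : Fin r → S, ENNReal.ofReal
        (ψ fun k => if h : (k : ℕ) < s then z ⟨k, h⟩ else y k) ∂(Measure.pi fun _ => P) ≤
      ENNReal.ofReal (projKernel P s ψ z) := by
  let e : Fin r → Fin s ⊕ Fin r := fun k => if h : (k : ℕ) < s then .inl ⟨k, h⟩ else .inr k
  have he : e.Injective := by
    intro k l hkl
    simp only [e] at hkl
    split_ifs at hkl <;> simp_all [Fin.ext_iff]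
  have hmp := measurePreserving_sumElim_comp P he
  have hfun : (fun (z : (Fin s → S) × (Fin r → S)) (i : Fin r) => Sum.elim z.1 z.2 (e i)) =
      fun (z : (Fin s → S) × (Fin r → S)) (k : Fin r) =>
        if h : (k : ℕ) < s then z.1 ⟨k, h⟩ else z.2 k := by
    funext z k
    simp only [e]
    split_ifs <;> rfl
  rw [hfun] at hmp
  filter_upwards [(hmp.integrable_comp_of_integrable hint).prod_right_ae] with z hz
  exact (ofReal_integral_eq_lintegral_ofReal hz (ae_of_all _ fun _ => h0 _)).ge

/-- Resampling the coordinates `t_k`, `k ≥ s`, leaves a factor depending only on `U` unchanged and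
replaces `ψ` by its projection `P^{r-s}ψ`. -/
theorem lintegral_mul_splitTuples_le [IsProbabilityMeasure P] (hψ : Measurable ψ)
    (hint : Integrable ψ (Measure.pi fun _ => P)) (h0 : ∀ x, 0 ≤ ψ x) {s : ℕ} (hs : s ≤ r)
    {U : Finset (Fin n)} {t : Fin r → Fin n} (ht : t ∈ splitTuples r s U)
    {G : (Fin n → S) → ℝ≥0∞} (hG : Measurable G) (hGU : DependsOn G (U : Set (Fin n))) :
    ∫⁻ x, G x * ENNReal.ofReal (ψ fun k => x (t k)) ∂(Measure.pi fun _ => P) ≤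
      ∫⁻ x, G x * ENNReal.ofReal (projKernel P s ψ fun k : Fin s => x (t (k.castLE hs)))
        ∂(Measure.pi fun _ => P) := by
  classical
  simp only [splitTuples, Finset.mem_filter, Finset.mem_univ, true_and] at ht
  obtain ⟨htinj, htU⟩ := ht
  let e : Fin n → Fin n ⊕ Fin r := fun a =>
    if h : ∃ k : Fin r, s ≤ (k : ℕ) ∧ t k = a then .inr h.choose else .inl a
  have he_inr : ∀ k : Fin r, s ≤ (k : ℕ) → e (t k) = .inr k := by
    intro k hk
    have h : ∃ l : Fin r, s ≤ (l : ℕ) ∧ t l = t k := ⟨k, hk, rfl⟩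
    simp only [e, dif_pos h]
    exact congrArg _ (htinj h.choose_spec.2)
  have he_inl : ∀ a, (∀ k : Fin r, s ≤ (k : ℕ) → t k ≠ a) → e a = .inl a := by
    intro a ha
    simp only [e]
    rw [dif_neg]
    rintro ⟨k, hk, hka⟩
    exact ha k hk hka
  have he : e.Injective := by
    intro a b hab
    by_cases ha : ∃ k : Fin r, s ≤ (k : ℕ) ∧ t k = a <;>
      by_cases hb : ∃ k : Fin r, s ≤ (k : ℕ) ∧ t k = b
    · obtain ⟨k, hk, rfl⟩ := ha
      obtain ⟨l, hl, rfl⟩ := hb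
      rw [he_inr k hk, he_inr l hl] at hab
      rw [Sum.inr.inj hab]
    · simp [e, ha, hb] at hab
    · simp [e, ha, hb] at hab
    · simpa [e, ha, hb] using hab
  have hmp := measurePreserving_sumElim_comp P he
  have hmeas : Measurable fun x : Fin n → S => G x * ENNReal.ofReal (ψ fun k => x (t k)) :=
    hG.mul (hψ.comp (by fun_prop)).ennreal_ofReal
  have hkeep : ∀ z : (Fin n → S) × (Fin r → S),
      G (fun i => Sum.elim z.1 z.2 (e i)) = G z.1 := by
    intro z
    refine hGU fun a ha => ?_
    rw [he_inl a, Sum.elim_inl]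
    rintro k hk rfl
    exact absurd ((htU k).1 ha) hk.not_gt
  have hglue : ∀ z : (Fin n → S) × (Fin r → S),
      (fun k => Sum.elim z.1 z.2 (e (t k))) =
        fun k : Fin r => if h : (k : ℕ) < s then
          (fun l : Fin s => z.1 (t (l.castLE hs))) ⟨k, h⟩ else z.2 k := by
    intro z
    funext k
    split_ifs with h
    · rw [he_inl (t k), Sum.elim_inl]
      · rfl
      · intro l hl hlk
        rw [htinj hlk] at hl
        omega
    · rw [he_inr k (not_lt.1 h), Sum.elim_inr]
  rw [← hmp.lintegral_comp hmeas]
  simp only [hkeep, hglue]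
  rw [lintegral_prod]
  · have hsub : MeasurePreserving (fun (x : Fin n → S) (k : Fin s) => x (t (k.castLE hs)))
        (Measure.pi fun _ => P) (Measure.pi fun _ => P) :=
      measurePreserving_comp_injective P
        (e := fun k : Fin s => t (k.castLE hs)) (htinj.comp (Fin.castLE_injective hs))
    refine lintegral_mono_ae ?_
    filter_upwards [hsub.quasiMeasurePreserving.ae
      (lintegral_le_ofReal_projKernel hint h0 s)] with x hx
    rw [lintegral_const_mul]
    · exact mul_le_mul_right hx _
    · refine (hψ.comp (measurable_pi_lambda _ fun k => ?_)).ennreal_ofReal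
      split_ifs <;> fun_prop
  · refine ((hG.comp measurable_fst).mul (hψ.comp
      (measurable_pi_lambda _ fun k => ?_)).ennreal_ofReal).aemeasurable
    split_ifs <;> fun_prop

/-- The quantity that controls `J_r(ψ)` through the sample points in `U` alone:
`ε + ∑_{s ≤ r} n^{r-s} L^s sup P^{r-s}ψ(x_{i_1}, …, x_{i_s})`, the supremum being over the tuples of
distinct indices in `U`. The summand `ε > 0` makes it possible to divide by the envelope. -/
noncomputable def projEnvelope (P : Measure S) (ψ : (Fin r → S) → ℝ) (L ε : ℝ≥0∞)
    (U : Finset (Fin n)) (x : Fin n → S) : ℝ≥0∞ :=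
  ε + ∑ s ∈ Finset.range (r + 1), (n : ℝ≥0∞) ^ (r - s) * L ^ s *
    ⨆ i : {i : Fin s ↪ Fin n // ∀ k, i k ∈ U},
      ENNReal.ofReal (projKernel P s ψ fun k => x (i.1 k))

variable {L ε : ℝ≥0∞} {U V : Finset (Fin n)}

theorem measurable_projEnvelope [IsProbabilityMeasure P] (hψ : Measurable ψ) :
    Measurable (projEnvelope P ψ L ε U) := by
  refine measurable_const.add (Finset.measurable_sum _ fun s _ => measurable_const.mul ?_)
  exact Measurable.iSup fun i =>
    ((measurable_projKernel P hψ s).comp (by fun_prop)).ennreal_ofReal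

theorem dependsOn_projEnvelope : DependsOn (projEnvelope P ψ L ε U) (U : Set (Fin n)) := by
  intro x y hxy
  unfold projEnvelope
  congr! 8 with s _ i k
  exact hxy _ (i.2 k)

theorem projEnvelope_mono (h : U ⊆ V) (x : Fin n → S) :
    projEnvelope P ψ L ε U x ≤ projEnvelope P ψ L ε V x := by
  unfold projEnvelope
  gcongr
  exact iSup_le fun i => le_iSup (fun i : {i : Fin _ ↪ Fin n // ∀ k, i k ∈ V} =>
    ENNReal.ofReal (projKernel P _ ψ fun k => x (i.1 k))) ⟨i.1, fun k => h (i.2 k)⟩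

theorem projEnvelope_le (x : Fin n → S) :
    projEnvelope P ψ L ε U x ≤ ε + ∑ s ∈ Finset.range (r + 1),
      (n : ℝ≥0∞) ^ (r - s) * L ^ s * ENNReal.ofReal (maxKernel (projKernel P s ψ) x) := by
  unfold projEnvelope maxKernel
  gcongr
  refine iSup_le fun i => ENNReal.ofReal_le_ofReal ((le_abs_self _).trans ?_)
  exact le_ciSup (f := fun i : Fin _ ↪ Fin n => |projKernel P _ ψ fun k => x (i k)|)
    (Set.finite_range _).bddAbove i.1

theorem projEnvelope_ne_top (hL : L ≠ ∞) (hε : ε ≠ ∞) (x : Fin n → S) :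
    projEnvelope P ψ L ε U x ≠ ∞ := by
  refine ne_top_of_le_ne_top (ENNReal.add_ne_top.2 ⟨hε, ?_⟩) (projEnvelope_le x)
  exact ENNReal.sum_ne_top.2 fun s _ => ENNReal.mul_ne_top (ENNReal.mul_ne_top
    (ENNReal.pow_ne_top (ENNReal.natCast_ne_top n)) (ENNReal.pow_ne_top hL)) ENNReal.ofReal_ne_top

theorem projEnvelope_ne_zero (hε : ε ≠ 0) (x : Fin n → S) : projEnvelope P ψ L ε U x ≠ 0 :=
  fun h => hε (add_eq_zero.1 h).1

/-- Against a weight that depends only on the sample points in `U`, the statistic `J_r(ψ)` is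
dominated by the envelope over `U`: a tuple with `s` entries in `U` contributes a value of
`P^{r-s}ψ`, and there are at most `|U|^s n^{r-s}` such tuples. -/
theorem lintegral_mul_uStat_le [IsProbabilityMeasure P] (hψ : Measurable ψ)
    (hint : Integrable ψ (Measure.pi fun _ => P)) (h0 : ∀ x, 0 ≤ ψ x)
    (hsym : IsSymmetricKernel ψ) {κ : ℝ≥0∞} (hκ : 1 ≤ κ) (hU : (U.card : ℝ≥0∞) ≤ κ * L)
    {G : (Fin n → S) → ℝ≥0∞} (hG : Measurable G) (hGU : DependsOn G (U : Set (Fin n))) :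
    ∫⁻ x, G x * ENNReal.ofReal (uStat ψ x) ∂(Measure.pi fun _ => P) ≤
      κ ^ r * ∫⁻ x, G x * projEnvelope P ψ L ε U x ∂(Measure.pi fun _ => P) := by
  let B : ℕ → (Fin n → S) → ℝ≥0∞ := fun s x => ⨆ i : {i : Fin s ↪ Fin n // ∀ k, i k ∈ U},
    ENNReal.ofReal (projKernel P s ψ fun k => x (i.1 k))
  have hB : ∀ s, Measurable (B s) := fun s => Measurable.iSup fun i =>
    ((measurable_projKernel P hψ s).comp (by fun_prop)).ennreal_ofReal
  have hψt : ∀ t : Fin r → Fin n,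
      Measurable fun x : Fin n → S => G x * ENNReal.ofReal (ψ fun k => x (t k)) :=
    fun t => hG.mul (hψ.comp (by fun_prop)).ennreal_ofReal
  calc ∫⁻ x, G x * ENNReal.ofReal (uStat ψ x) ∂(Measure.pi fun _ => P)
      ≤ ∫⁻ x, ∑ s ∈ Finset.range (r + 1), ∑ t ∈ splitTuples r s U,
          G x * ENNReal.ofReal (ψ fun k => x (t k)) ∂(Measure.pi fun _ => P) := by
        refine lintegral_mono fun x => ?_
        simp only [← Finset.mul_sum]
        exact mul_le_mul_right (ofReal_uStat_le_sum_splitTuples h0 hsym U x) _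
    _ = ∑ s ∈ Finset.range (r + 1), ∑ t ∈ splitTuples r s U,
          ∫⁻ x, G x * ENNReal.ofReal (ψ fun k => x (t k)) ∂(Measure.pi fun _ => P) := by
        rw [lintegral_finsetSum _ fun s _ => Finset.measurable_sum _ fun t _ => hψt t]
        exact Finset.sum_congr rfl fun s _ => lintegral_finsetSum _ fun t _ => hψt t
    _ ≤ ∑ s ∈ Finset.range (r + 1), ∑ t ∈ splitTuples r s U,
          ∫⁻ x, G x * B s x ∂(Measure.pi fun _ => P) := by
        refine Finset.sum_le_sum fun s hs => Finset.sum_le_sum fun t ht => ?_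
        have hsr : s ≤ r := Nat.lt_succ_iff.1 (Finset.mem_range.1 hs)
        refine (lintegral_mul_splitTuples_le hψ hint h0 hsr ht hG hGU).trans
          (lintegral_mono fun x => mul_le_mul_right ?_ _)
        simp only [splitTuples, Finset.mem_filter, Finset.mem_univ, true_and] at ht
        exact le_iSup (fun i : {i : Fin s ↪ Fin n // ∀ k, i k ∈ U} =>
            ENNReal.ofReal (projKernel P s ψ fun k => x (i.1 k)))
          ⟨⟨fun k => t (k.castLE hsr), ht.1.comp (Fin.castLE_injective hsr)⟩,
            fun k => (ht.2 _).2 k.2⟩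
    _ ≤ ∑ s ∈ Finset.range (r + 1), κ ^ r * ((n : ℝ≥0∞) ^ (r - s) * L ^ s *
          ∫⁻ x, G x * B s x ∂(Measure.pi fun _ => P)) := by
        refine Finset.sum_le_sum fun s hs => ?_
        have hsr : s ≤ r := Nat.lt_succ_iff.1 (Finset.mem_range.1 hs)
        rw [Finset.sum_const, nsmul_eq_mul, ← mul_assoc]
        refine mul_le_mul_left ?_ _
        calc ((splitTuples r s U).card : ℝ≥0∞)
            ≤ (U.card : ℝ≥0∞) ^ s * (n : ℝ≥0∞) ^ (r - s) := by
              exact_mod_cast card_splitTuples_le hsr U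
          _ ≤ (κ * L) ^ s * (n : ℝ≥0∞) ^ (r - s) := by gcongr
          _ = κ ^ s * ((n : ℝ≥0∞) ^ (r - s) * L ^ s) := by rw [mul_pow]; ring
          _ ≤ κ ^ r * ((n : ℝ≥0∞) ^ (r - s) * L ^ s) := by gcongr
    _ = κ ^ r * ∫⁻ x, ∑ s ∈ Finset.range (r + 1), G x * ((n : ℝ≥0∞) ^ (r - s) * L ^ s * B s x)
          ∂(Measure.pi fun _ => P) := by
        rw [← Finset.mul_sum, lintegral_finsetSum]
        swap
        · exact fun s _ => hG.mul (measurable_const.mul (hB s))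
        congr 1
        refine Finset.sum_congr rfl fun s _ => ?_
        rw [← lintegral_const_mul _ (by exact hG.mul (hB s))]
        exact lintegral_congr fun x => mul_left_comm _ _ _
    _ ≤ _ := by
        refine mul_le_mul_right (lintegral_mono fun x => ?_) _
        rw [← Finset.mul_sum]
        exact mul_le_mul_right le_add_self _

end Projection

/-! ### Self-normalised moments -/

section Moments

variable {S : Type*} [MeasurableSpace S] {P : Measure S} {n r : ℕ}
  {ψ : (Fin r → S) → ℝ} {L ε κ : ℝ≥0∞} {U : Finset (Fin n)} {G : (Fin n → S) → ℝ≥0∞}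

theorem measurable_ofReal_uStat (hψ : Measurable ψ) :
    Measurable fun x : Fin n → S => ENNReal.ofReal (uStat ψ x) := by
  unfold uStat
  exact (Finset.measurable_sum _ fun i _ => hψ.comp (by fun_prop)).ennreal_ofReal

/-- Writing one factor `J_r(ψ)` as a sum and absorbing each summand `ψ(x_{i_1}, …, x_{i_r})` into
the weight, which then depends on at most `r` further sample points. -/
theorem lintegral_mul_uStat_mul_le (hψ : Measurable ψ) (h0 : ∀ x, 0 ≤ ψ x)
    {ν : Measure (Fin n → S)} {C : ℝ≥0∞} {M : ℕ} {H H' : (Fin n → S) → ℝ≥0∞}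
    (hH : Measurable H) (hH' : Measurable H') (hU : U.card + r ≤ M)
    (hyp : ∀ (V : Finset (Fin n)) (F : (Fin n → S) → ℝ≥0∞), V.card ≤ M → Measurable F →
      DependsOn F (V : Set (Fin n)) → ∫⁻ x, F x * H x ∂ν ≤ C * ∫⁻ x, F x * H' x ∂ν)
    (hG : Measurable G) (hGU : DependsOn G (U : Set (Fin n))) :
    ∫⁻ x, G x * (ENNReal.ofReal (uStat ψ x) * H x) ∂ν ≤
      C * ∫⁻ x, G x * (ENNReal.ofReal (uStat ψ x) * H' x) ∂ν := by
  classical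
  have hFm : ∀ i : Fin r → Fin n,
      Measurable fun x : Fin n → S => G x * ENNReal.ofReal (ψ fun k => x (i k)) :=
    fun i => hG.mul (hψ.comp (by fun_prop)).ennreal_ofReal
  have expand : ∀ K : (Fin n → S) → ℝ≥0∞, Measurable K →
      ∫⁻ x, G x * (ENNReal.ofReal (uStat ψ x) * K x) ∂ν =
        ∑ i with StrictMono (α := Fin r) (β := Fin n) i,
          ∫⁻ x, G x * ENNReal.ofReal (ψ fun k => x (i k)) * K x ∂ν := by
    intro K hK
    rw [← lintegral_finsetSum _ fun i _ => by exact (hFm i).mul hK]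
    refine lintegral_congr fun x => ?_
    rw [ofReal_uStat h0, ← mul_assoc, Finset.mul_sum, Finset.sum_mul]
  rw [expand H hH, expand H' hH', Finset.mul_sum]
  refine Finset.sum_le_sum fun i _ => hyp (U ∪ Finset.univ.image i) _ ?_ (hFm i) ?_
  · refine (Finset.card_union_le _ _).trans (le_trans ?_ hU)
    gcongr
    simpa using Finset.card_image_le (s := (Finset.univ : Finset (Fin r))) (f := i)
  · intro x y hxy
    have h1 : G x = G y := hGU fun a ha => hxy a (by simp [Finset.mem_coe.1 ha])
    have h2 : (fun k => x (i k)) = fun k => y (i k) := funext fun k => hxy _ (by simp)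
    simp only [h1, h2]

variable [IsProbabilityMeasure P]

/-- One step of the recursion: the exponent of `J / D` goes down by one, at the price of the factor
`κ ^ r`, because `D` dominates the envelope over `U` and the latter can be put into the weight. -/
theorem lintegral_mul_rpow_mul_div_pow_succ_le (hψ : Measurable ψ)
    (hint : Integrable ψ (Measure.pi fun _ => P)) (h0 : ∀ x, 0 ≤ ψ x)
    (hsym : IsSymmetricKernel ψ) (hκ : 1 ≤ κ) (hL : L ≠ ∞) (hε : ε ≠ 0) (hε' : ε ≠ ∞)
    {M N : ℕ} (hM : (M : ℝ≥0∞) ≤ κ * L) {θ : ℝ} (hθ0 : 0 ≤ θ) (hθ1 : θ ≤ 1)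
    (hyp : ∀ (V : Finset (Fin n)) (F : (Fin n → S) → ℝ≥0∞), V.card + r * N ≤ M → Measurable F →
      DependsOn F (V : Set (Fin n)) →
      ∫⁻ x, F x * (ENNReal.ofReal (uStat ψ x) / projEnvelope P ψ L ε Finset.univ x) ^ N
        ∂(Measure.pi fun _ => P) ≤ (κ ^ r) ^ N * ∫⁻ x, F x ∂(Measure.pi fun _ => P))
    (hU : U.card + r * (N + 1) ≤ M) (hG : Measurable G) (hGU : DependsOn G (U : Set (Fin n))) :
    ∫⁻ x, G x * (projEnvelope P ψ L ε Finset.univ x ^ θ *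
        (ENNReal.ofReal (uStat ψ x) / projEnvelope P ψ L ε Finset.univ x) ^ (N + 1))
        ∂(Measure.pi fun _ => P) ≤
      (κ ^ r) ^ (N + 1) * ∫⁻ x, G x * projEnvelope P ψ L ε Finset.univ x ^ θ
        ∂(Measure.pi fun _ => P) := by
  set D : (Fin n → S) → ℝ≥0∞ := projEnvelope P ψ L ε Finset.univ with hD
  set E : (Fin n → S) → ℝ≥0∞ := projEnvelope P ψ L ε U with hE
  have hDm : Measurable D := measurable_projEnvelope hψ
  have hEm : Measurable E := measurable_projEnvelope hψ
  have hJm := measurable_ofReal_uStat (n := n) hψ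
  have hED : ∀ x, E x ≤ D x := projEnvelope_mono (Finset.subset_univ U)
  have hE0 : ∀ x, E x ≠ 0 := projEnvelope_ne_zero hε
  have hEtop : ∀ x, E x ≠ ∞ := projEnvelope_ne_top hL hε'
  have hD0 : ∀ x, D x ≠ 0 := projEnvelope_ne_zero hε
  have hDtop : ∀ x, D x ≠ ∞ := projEnvelope_ne_top hL hε'
  have hWm : Measurable fun x => G x * E x ^ (θ - 1) := hG.mul (hEm.pow_const _)
  have hWU : DependsOn (fun x => G x * E x ^ (θ - 1)) (U : Set (Fin n)) := by
    intro x y hxy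
    have h1 : G x = G y := hGU hxy
    have h2 : E x = E y := dependsOn_projEnvelope hxy
    simp only [h1, h2]
  have hUM : U.card + r * N + r ≤ M := by rw [mul_add, mul_one, ← add_assoc] at hU; exact hU
  calc ∫⁻ x, G x * (D x ^ θ * (ENNReal.ofReal (uStat ψ x) / D x) ^ (N + 1))
        ∂(Measure.pi fun _ => P)
      ≤ ∫⁻ x, G x * E x ^ (θ - 1) * (ENNReal.ofReal (uStat ψ x) *
          (ENNReal.ofReal (uStat ψ x) / D x) ^ N) ∂(Measure.pi fun _ => P) := by
        refine lintegral_mono fun x => ?_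
        have h1 : D x ^ θ * (D x)⁻¹ ≤ E x ^ (θ - 1) := by
          rw [← ENNReal.rpow_neg_one, ← ENNReal.rpow_add _ _ (hD0 x) (hDtop x),
            ← sub_eq_add_neg]
          rw [← neg_sub 1 θ, ENNReal.rpow_neg, ENNReal.rpow_neg, ENNReal.inv_le_inv]
          exact ENNReal.rpow_le_rpow (hED x) (by linarith)
        calc G x * (D x ^ θ * (ENNReal.ofReal (uStat ψ x) / D x) ^ (N + 1))
            = G x * (D x ^ θ * (D x)⁻¹) * (ENNReal.ofReal (uStat ψ x) *
                (ENNReal.ofReal (uStat ψ x) / D x) ^ N) := by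
              rw [pow_succ, div_eq_mul_inv]; ring
          _ ≤ _ := by gcongr
    _ ≤ (κ ^ r) ^ N * ∫⁻ x, G x * E x ^ (θ - 1) * (ENNReal.ofReal (uStat ψ x) * 1)
          ∂(Measure.pi fun _ => P) := by
        refine lintegral_mul_uStat_mul_le (M := U.card + r) hψ h0 ((hJm.div hDm).pow_const N)
          measurable_const le_rfl (fun V F hV hF hFV => ?_) hWm hWU
        simp only [mul_one]
        exact hyp V F (by omega) hF hFV
    _ ≤ (κ ^ r) ^ N * (κ ^ r * ∫⁻ x, G x * E x ^ (θ - 1) * E x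
          ∂(Measure.pi fun _ => P)) := by
        simp only [mul_one]
        refine mul_le_mul_right (lintegral_mul_uStat_le hψ hint h0 hsym hκ ?_ hWm hWU) _
        exact le_trans (Nat.cast_le.2 (by omega)) hM
    _ ≤ (κ ^ r) ^ (N + 1) * ∫⁻ x, G x * D x ^ θ ∂(Measure.pi fun _ => P) := by
        rw [pow_succ, ← mul_assoc]
        refine mul_le_mul_right (lintegral_mono fun x => ?_) _
        have h1 : E x ^ (θ - 1) * E x = E x ^ θ := by
          conv_lhs => rw [← ENNReal.rpow_one (E x)]
          rw [← ENNReal.rpow_mul, one_mul, ← ENNReal.rpow_add _ _ (hE0 x) (hEtop x),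
            sub_add_cancel]
        simp only [mul_assoc, h1]
        gcongr
        exact hED x

theorem lintegral_mul_div_pow_le (hψ : Measurable ψ)
    (hint : Integrable ψ (Measure.pi fun _ => P)) (h0 : ∀ x, 0 ≤ ψ x)
    (hsym : IsSymmetricKernel ψ) (hκ : 1 ≤ κ) (hL : L ≠ ∞) (hε : ε ≠ 0) (hε' : ε ≠ ∞)
    {M : ℕ} (hM : (M : ℝ≥0∞) ≤ κ * L) (N : ℕ) (U : Finset (Fin n)) (G : (Fin n → S) → ℝ≥0∞)
    (hU : U.card + r * N ≤ M) (hG : Measurable G) (hGU : DependsOn G (U : Set (Fin n))) :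
    ∫⁻ x, G x * (ENNReal.ofReal (uStat ψ x) / projEnvelope P ψ L ε Finset.univ x) ^ N
      ∂(Measure.pi fun _ => P) ≤ (κ ^ r) ^ N * ∫⁻ x, G x ∂(Measure.pi fun _ => P) := by
  induction N generalizing U G with
  | zero => simp
  | succ N ih =>
    simpa using lintegral_mul_rpow_mul_div_pow_succ_le hψ hint h0 hsym hκ hL hε hε' hM le_rfl
      zero_le_one ih hU hG hGU

/-- Multiplying the weight `J ^ b * D ^ θ` by a power of the self-normalised statistic `J / D`
increases its integral by a geometric factor at most, as long as the number `b + N + 1` of factors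
is of the order of `L`. -/
theorem lintegral_mul_pow_mul_rpow_mul_div_pow_le (hψ : Measurable ψ)
    (hint : Integrable ψ (Measure.pi fun _ => P)) (h0 : ∀ x, 0 ≤ ψ x)
    (hsym : IsSymmetricKernel ψ) (hκ : 1 ≤ κ) (hL : L ≠ ∞) (hε : ε ≠ 0) (hε' : ε ≠ ∞)
    {M : ℕ} (hM : (M : ℝ≥0∞) ≤ κ * L) (N : ℕ) {θ : ℝ} (hθ0 : 0 ≤ θ) (hθ1 : θ ≤ 1) (b : ℕ)
    (U : Finset (Fin n)) (G : (Fin n → S) → ℝ≥0∞) (hU : U.card + r * (b + (N + 1)) ≤ M)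
    (hG : Measurable G) (hGU : DependsOn G (U : Set (Fin n))) :
    ∫⁻ x, G x * (ENNReal.ofReal (uStat ψ x) ^ b * (projEnvelope P ψ L ε Finset.univ x ^ θ *
        (ENNReal.ofReal (uStat ψ x) / projEnvelope P ψ L ε Finset.univ x) ^ (N + 1)))
        ∂(Measure.pi fun _ => P) ≤
      (κ ^ r) ^ (N + 1) * ∫⁻ x, G x * (ENNReal.ofReal (uStat ψ x) ^ b *
        projEnvelope P ψ L ε Finset.univ x ^ θ) ∂(Measure.pi fun _ => P) := by
  have hDm : Measurable (projEnvelope P ψ L ε (Finset.univ : Finset (Fin n))) :=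
    measurable_projEnvelope hψ
  have hJm := measurable_ofReal_uStat (n := n) hψ
  induction b generalizing U G with
  | zero =>
    simp only [pow_zero, one_mul]
    exact lintegral_mul_rpow_mul_div_pow_succ_le hψ hint h0 hsym hκ hL hε hε' hM hθ0 hθ1
      (fun V F => lintegral_mul_div_pow_le hψ hint h0 hsym hκ hL hε hε' hM N V F)
      (by simpa using hU) hG hGU
  | succ b ih =>
    simp only [pow_succ' _ b, mul_assoc (ENNReal.ofReal _)]
    refine lintegral_mul_uStat_mul_le (M := U.card + r) hψ h0
      ((hJm.pow_const b).mul ((hDm.pow_const θ).mul ((hJm.div hDm).pow_const (N + 1))))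
      ((hJm.pow_const b).mul (hDm.pow_const θ)) le_rfl (fun V F hV hF hFV => ?_) hG hGU
    refine ih V F ?_ hF hFV
    have : r * (b + 1 + (N + 1)) = r * (b + (N + 1)) + r := by ring
    omega

end Moments

/-! ### Maxima over a finite family of kernels -/

/-- Where `J > A D`, the excess of `J ^ q` is charged to a high power of `J / D`. -/
theorem rpow_le_rpow_add_pow_mul_div_pow {J D A : ℝ≥0∞} (hD0 : D ≠ 0) (hD : D ≠ ∞) (hA1 : 1 ≤ A)
    (hA : A ≠ ∞) (b N : ℕ) {θ : ℝ} (hθ0 : 0 ≤ θ) (hθ1 : θ ≤ 1) :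
    J ^ (b + θ : ℝ) ≤ (A * D) ^ (b + θ : ℝ) +
      A * (A⁻¹) ^ (N + 1) * (J ^ b * (D ^ θ * (J / D) ^ (N + 1))) := by
  have hq : 0 ≤ (b + θ : ℝ) := by positivity
  have hA0 : A ≠ 0 := (one_pos.trans_le hA1).ne'
  have hAD0 : A * D ≠ 0 := mul_ne_zero hA0 hD0
  have hADtop : A * D ≠ ∞ := ENNReal.mul_ne_top hA hD
  rcases le_total J (A * D) with h | h
  · exact (ENNReal.rpow_le_rpow h hq).trans le_self_add
  · refine le_trans ?_ le_add_self
    have h1 : 1 ≤ J / (A * D) := by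
      rw [ENNReal.le_div_iff_mul_le (.inl hAD0) (.inl hADtop), one_mul]
      exact h
    have h2 : J / (A * D) = A⁻¹ * (J / D) := by
      rw [div_eq_mul_inv, div_eq_mul_inv, ENNReal.mul_inv (.inl hA0) (.inl hA)]
      ring
    calc J ^ (b + θ : ℝ) = J ^ b * (J / (A * D) * (A * D)) ^ θ := by
          rw [ENNReal.div_mul_cancel hAD0 hADtop,
            ENNReal.rpow_add_of_nonneg _ _ (by positivity) hθ0, ENNReal.rpow_natCast]
      _ = J ^ b * ((J / (A * D)) ^ θ * (A ^ θ * D ^ θ)) := by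
          rw [ENNReal.mul_rpow_of_nonneg _ _ hθ0, ENNReal.mul_rpow_of_nonneg _ _ hθ0]
      _ ≤ J ^ b * ((A⁻¹ * (J / D)) ^ (N + 1) * (A * D ^ θ)) := by
          gcongr
          · rw [← h2, ← ENNReal.rpow_natCast]
            refine ENNReal.rpow_le_rpow_of_exponent_le h1 (hθ1.trans ?_)
            push_cast
            linarith [(Nat.cast_nonneg N : (0 : ℝ) ≤ N)]
          · exact (ENNReal.rpow_le_rpow_of_exponent_le hA1 hθ1).trans_eq (ENNReal.rpow_one A)
      _ = _ := by rw [mul_pow]; ring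

theorem pow_mul_rpow_le_rpow_add_rpow (J D : ℝ≥0∞) (b : ℕ) {θ : ℝ} (hθ0 : 0 ≤ θ) :
    J ^ b * D ^ θ ≤ J ^ (b + θ : ℝ) + D ^ (b + θ : ℝ) := by
  have hq : 0 ≤ (b + θ : ℝ) := by positivity
  have h : J ^ b * D ^ θ ≤ (max J D) ^ (b + θ : ℝ) := by
    rw [ENNReal.rpow_add_of_nonneg _ _ (by positivity) hθ0, ENNReal.rpow_natCast]
    gcongr
    · exact le_max_left _ _
    · exact le_max_right _ _
  refine h.trans ?_
  rcases le_total J D with h | h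
  · rw [max_eq_right h]; exact le_add_self
  · rw [max_eq_left h]; exact le_self_add

/-- The constant `A = 12 K ^ 2` makes the geometric factor small enough to be summed over a family
of `p` kernels. -/
theorem card_mul_geometric_factor_le {K p N : ℕ} (hK : 1 ≤ K) (hN : 1 ≤ N) (hp : p ≤ 3 ^ N) :
    (p : ℝ≥0∞) * ((12 * K ^ 2 : ℕ) * ((12 * K ^ 2 : ℕ) : ℝ≥0∞)⁻¹ ^ (N + 1) * (K : ℝ≥0∞) ^ (N + 1)) ≤
      4⁻¹ := by
  have hnat : 4 * (p * K ^ (N + 1)) ≤ (12 * K ^ 2) ^ N := by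
    have h4 : 4 ≤ 4 ^ N := Nat.le_self_pow (by omega) 4
    have hKN : K ≤ K ^ N := Nat.le_self_pow (by omega) K
    calc 4 * (p * K ^ (N + 1)) = 4 * p * K * K ^ N := by ring
      _ ≤ 4 ^ N * 3 ^ N * K ^ N * K ^ N := by gcongr
      _ = (4 * 3 * K * K) ^ N := by simp only [mul_pow]
      _ = (12 * K ^ 2) ^ N := by congr 1; ring
  have hA0 : ((12 * K ^ 2 : ℕ) : ℝ≥0∞) ≠ 0 := by
    have : 0 < 12 * K ^ 2 := by positivity
    exact_mod_cast this.ne'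
  have hcast : 4 * ((p : ℝ≥0∞) * (K : ℝ≥0∞) ^ (N + 1)) ≤ ((12 * K ^ 2 : ℕ) : ℝ≥0∞) ^ N := by
    exact_mod_cast hnat
  generalize ((12 * K ^ 2 : ℕ) : ℝ≥0∞) = A at hA0 hcast
  by_cases hAtop : A = ∞
  · simp [hAtop]
  have h1 : (p : ℝ≥0∞) * (A * A⁻¹ ^ (N + 1) * (K : ℝ≥0∞) ^ (N + 1)) =
      p * (K : ℝ≥0∞) ^ (N + 1) * (A ^ N)⁻¹ := by
    rw [pow_succ' A⁻¹, ← mul_assoc A, ENNReal.mul_inv_cancel hA0 hAtop, one_mul, ENNReal.inv_pow]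
    ring
  rw [h1, ← div_eq_mul_inv]
  refine ENNReal.div_le_of_le_mul ?_
  rw [mul_comm 4⁻¹, ← div_eq_mul_inv,
    ENNReal.le_div_iff_mul_le (.inl (by norm_num)) (.inl (by norm_num)), mul_comm]
  exact hcast

theorem uStat_nonneg {S : Type*} {n r : ℕ} {ψ : (Fin r → S) → ℝ} (h0 : ∀ x, 0 ≤ ψ x)
    (x : Fin n → S) : 0 ≤ uStat ψ x :=
  Finset.sum_nonneg fun _ _ => h0 _

section Family

variable {S : Type*} [MeasurableSpace S] {P : Measure S} [IsProbabilityMeasure P] {n r p : ℕ}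

theorem lintegral_uStat_rpow_ne_top {ψ : (Fin r → S) → ℝ} {q : ℝ} (hq : 1 ≤ q)
    (hLp : MemLp ψ (ENNReal.ofReal q) (Measure.pi fun _ : Fin r => P)) (h0 : ∀ x, 0 ≤ ψ x) :
    ∫⁻ x : Fin n → S, ENNReal.ofReal (uStat ψ x) ^ q ∂(Measure.pi fun _ => P) ≠ ∞ := by
  classical
  have hmem : MemLp (fun x : Fin n → S => uStat ψ x) (ENNReal.ofReal q)
      (Measure.pi fun _ => P) := by
    unfold uStat
    refine memLp_finsetSum _ fun i hi => ?_
    have hi' : StrictMono i := by simpa using hi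
    exact hLp.comp_measurePreserving (measurePreserving_comp_injective P hi'.injective)
  have hq0 : ENNReal.ofReal q ≠ 0 := by
    rw [Ne, ENNReal.ofReal_eq_zero, not_le]; linarith
  have h := lintegral_rpow_enorm_lt_top_of_eLpNorm_lt_top hq0 ENNReal.ofReal_ne_top hmem.2
  rw [ENNReal.toReal_ofReal (by linarith)] at h
  simpa only [Real.enorm_of_nonneg (uStat_nonneg h0 _)] using h.ne

/-- The maximal inequality in terms of any common majorant `D` of the envelopes. The error terms of
the individual kernels add up to a quarter of the left-hand side, which is finite, and so they can
be absorbed. -/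
theorem lintegral_iSup_uStat_rpow_le {q l : ℝ} (hq : 1 ≤ q) (hql : q ≤ l)
    (hpl : (p : ℝ) ≤ Real.exp l) {ψ : Fin p → (Fin r → S) → ℝ} (hψ : ∀ j, Measurable (ψ j))
    (hLp : ∀ j, MemLp (ψ j) (ENNReal.ofReal q) (Measure.pi fun _ : Fin r => P))
    (hsym : ∀ j, IsSymmetricKernel (ψ j)) (h0 : ∀ j x, 0 ≤ ψ j x) {ε : ℝ≥0∞} (hε : ε ≠ 0)
    (hε' : ε ≠ ∞) {D : (Fin n → S) → ℝ≥0∞}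
    (hD : ∀ j x, projEnvelope P (ψ j) (ENNReal.ofReal l) ε Finset.univ x ≤ D x) :
    ∫⁻ x : Fin n → S, (⨆ j, ENNReal.ofReal (uStat (ψ j) x)) ^ q ∂(Measure.pi fun _ => P) ≤
      (2 * (12 * ((4 * r + 1) ^ r) ^ 2 : ℕ) : ℝ≥0∞) ^ q *
        ∫⁻ x, D x ^ q ∂(Measure.pi fun _ => P) := by
  set K : ℕ := (4 * r + 1) ^ r with hK
  have hK1 : 1 ≤ K := Nat.one_le_pow _ _ (by omega)
  set b : ℕ := ⌊q⌋₊
  obtain ⟨θ, hθ⟩ : ∃ θ, θ = q - b := ⟨_, rfl⟩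
  have hbq : (b : ℝ) ≤ q := Nat.floor_le (by linarith)
  have hθ0 : 0 ≤ θ := by linarith
  have hθ1 : θ ≤ 1 := by linarith [Nat.lt_floor_add_one q]
  have hqb : q = b + θ := by linarith
  set N : ℕ := ⌈l⌉₊
  have hlN : l ≤ N := Nat.le_ceil l
  have hN1 : 1 ≤ N := by
    have : (1 : ℝ) ≤ N := by linarith
    exact_mod_cast this
  have hp3 : p ≤ 3 ^ N := by
    have : (p : ℝ) ≤ 3 ^ N := by
      refine (hpl.trans (Real.exp_le_exp.2 hlN)).trans ?_
      rw [← Real.exp_one_pow]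
      gcongr
      exact Real.exp_one_lt_three.le
    exact_mod_cast this
  -- `b ≤ l` and `N ≤ l + 1`, so `b + N + 1 ≤ 4 l`
  have hM : ((r * (b + (N + 1)) : ℕ) : ℝ≥0∞) ≤ ((4 * r + 1 : ℕ) : ℝ≥0∞) * ENNReal.ofReal l := by
    rw [← ENNReal.ofReal_natCast, ← ENNReal.ofReal_natCast (4 * r + 1),
      ← ENNReal.ofReal_mul (by positivity)]
    refine ENNReal.ofReal_le_ofReal ?_
    have hNl : (N : ℝ) < l + 1 := Nat.ceil_lt_add_one (by linarith)
    push_cast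
    have hr : (0 : ℝ) ≤ r := Nat.cast_nonneg r
    have h1 : (b : ℝ) + (N + 1) ≤ 4 * l := by linarith
    nlinarith [mul_le_mul_of_nonneg_left h1 hr]
  set A : ℝ≥0∞ := ((12 * K ^ 2 : ℕ) : ℝ≥0∞) with hA
  have hA1 : 1 ≤ A := by
    have : 1 ≤ 12 * K ^ 2 := by nlinarith
    rw [hA]
    exact_mod_cast this
  have hAtop : A ≠ ∞ := ENNReal.natCast_ne_top _
  set ν : Measure (Fin n → S) := Measure.pi fun _ => P
  set J : Fin p → (Fin n → S) → ℝ≥0∞ := fun j x => ENNReal.ofReal (uStat (ψ j) x) with hJ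
  set E : Fin p → (Fin n → S) → ℝ≥0∞ := fun j =>
    projEnvelope P (ψ j) (ENNReal.ofReal l) ε Finset.univ with hE
  have hJm : ∀ j, Measurable (J j) := fun j => measurable_ofReal_uStat (hψ j)
  have hEm : ∀ j, Measurable (E j) := fun j => measurable_projEnvelope (hψ j)
  have hq0 : 0 ≤ q := by linarith
  set F : ℝ≥0∞ := ∫⁻ x, (⨆ j, J j x) ^ q ∂ν with hF
  set B : ℝ≥0∞ := ∫⁻ x, D x ^ q ∂ν with hB
  let R : Fin p → (Fin n → S) → ℝ≥0∞ := fun j x =>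
    A * (A⁻¹) ^ (N + 1) * (J j x ^ b * (E j x ^ θ * (J j x / E j x) ^ (N + 1)))
  have hRm : ∀ j, Measurable (R j) := fun j => measurable_const.mul
    (((hJm j).pow_const b).mul (((hEm j).pow_const θ).mul (((hJm j).div (hEm j)).pow_const _)))
  have hpoint : ∀ j x, J j x ^ q ≤ A ^ q * D x ^ q + R j x := by
    intro j x
    refine (?_ : J j x ^ q ≤ (A * E j x) ^ q + R j x).trans ?_
    · rw [hqb]
      exact rpow_le_rpow_add_pow_mul_div_pow (projEnvelope_ne_zero hε x)
        (projEnvelope_ne_top ENNReal.ofReal_ne_top hε' x) hA1 hAtop b N hθ0 hθ1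
    · rw [← ENNReal.mul_rpow_of_nonneg _ _ hq0]
      gcongr
      exact hD j x
  have hRint : ∀ j, ∫⁻ x, R j x ∂ν ≤ A * (A⁻¹) ^ (N + 1) * (K : ℝ≥0∞) ^ (N + 1) * (F + B) := by
    intro j
    have hint : Integrable (ψ j) (Measure.pi fun _ : Fin r => P) :=
      (hLp j).integrable (by rw [← ENNReal.ofReal_one]; exact ENNReal.ofReal_le_ofReal hq)
    have hmom := lintegral_mul_pow_mul_rpow_mul_div_pow_le (n := n) (hψ j) hint (h0 j) (hsym j)
      (κ := ((4 * r + 1 : ℕ) : ℝ≥0∞)) (by exact_mod_cast Nat.le_add_left 1 _)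
      ENNReal.ofReal_ne_top hε hε' hM N hθ0 hθ1 b ∅ (fun _ => 1) (by simp) measurable_const
      (fun _ _ _ => rfl)
    simp only [one_mul] at hmom
    calc ∫⁻ x, R j x ∂ν = A * (A⁻¹) ^ (N + 1) *
          ∫⁻ x, J j x ^ b * (E j x ^ θ * (J j x / E j x) ^ (N + 1)) ∂ν :=
          lintegral_const_mul _ (((hJm j).pow_const b).mul
            (((hEm j).pow_const θ).mul (((hJm j).div (hEm j)).pow_const _)))
      _ ≤ A * (A⁻¹) ^ (N + 1) * ((K : ℝ≥0∞) ^ (N + 1) *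
          ∫⁻ x, J j x ^ b * E j x ^ θ ∂ν) := by
          refine mul_le_mul_right (hmom.trans_eq ?_) _
          rw [hK, Nat.cast_pow]
      _ ≤ A * (A⁻¹) ^ (N + 1) * ((K : ℝ≥0∞) ^ (N + 1) * (F + B)) := by
          gcongr
          refine (lintegral_mono fun x => pow_mul_rpow_le_rpow_add_rpow (J j x) (E j x) b hθ0).trans
            ?_
          rw [← hqb, lintegral_add_left ((hJm j).pow_const q)]
          exact add_le_add
            (lintegral_mono fun x => ENNReal.rpow_le_rpow (le_iSup (fun j => J j x) j) hq0)
            (lintegral_mono fun x => ENNReal.rpow_le_rpow (hD j x) hq0)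
      _ = _ := by ring
  have hsup : ∀ x, (⨆ j, J j x) ^ q ≤ A ^ q * D x ^ q + ∑ j, R j x := by
    intro x
    rw [← ENNReal.le_rpow_inv_iff (by linarith : 0 < q)]
    refine iSup_le fun j => ?_
    rw [ENNReal.le_rpow_inv_iff (by linarith : 0 < q)]
    refine (hpoint j x).trans (add_le_add_right ?_ _)
    exact Finset.single_le_sum (f := fun j => R j x) (fun _ _ => zero_le) (Finset.mem_univ j)
  have hFtop : F ≠ ∞ := by
    have h1 : F ≤ ∑ j, ∫⁻ x, J j x ^ q ∂ν := by
      rw [← lintegral_finsetSum _ fun j _ => (hJm j).pow_const q]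
      refine lintegral_mono fun x => ?_
      rw [← ENNReal.le_rpow_inv_iff (by linarith : 0 < q)]
      refine iSup_le fun j => ?_
      rw [ENNReal.le_rpow_inv_iff (by linarith : 0 < q)]
      exact Finset.single_le_sum (f := fun j => J j x ^ q) (fun _ _ => zero_le)
        (Finset.mem_univ j)
    exact ne_top_of_le_ne_top
      (ENNReal.sum_ne_top.2 fun j _ => lintegral_uStat_rpow_ne_top hq (hLp j) (h0 j)) h1
  have hmain : F ≤ A ^ q * B + 4⁻¹ * (F + B) := by
    calc F ≤ ∫⁻ x, (A ^ q * D x ^ q + ∑ j, R j x) ∂ν := lintegral_mono hsup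
      _ = A ^ q * B + ∑ j, ∫⁻ x, R j x ∂ν := by
          rw [lintegral_add_right _ (Finset.measurable_sum _ fun j _ => hRm j),
            lintegral_const_mul' _ _ (ENNReal.rpow_ne_top_of_nonneg hq0 hAtop),
            lintegral_finsetSum _ fun j _ => hRm j]
      _ ≤ A ^ q * B + ∑ _j : Fin p, A * (A⁻¹) ^ (N + 1) * (K : ℝ≥0∞) ^ (N + 1) * (F + B) := by
          gcongr with j
          exact hRint j
      _ ≤ A ^ q * B + 4⁻¹ * (F + B) := by
          rw [Finset.sum_const, Finset.card_univ, Fintype.card_fin, nsmul_eq_mul, ← mul_assoc]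
          gcongr
          exact card_mul_geometric_factor_le hK1 hN1 hp3
  rcases eq_or_ne B ∞ with hBtop | hBtop
  · rw [hBtop, ENNReal.mul_top]
    · exact le_top
    · have : (2 * A) ≠ 0 := mul_ne_zero two_ne_zero (one_pos.trans_le hA1).ne'
      simp [ENNReal.rpow_eq_zero_iff, this, hq0.not_gt]
  have hAq : A ^ q ≠ ∞ := ENNReal.rpow_ne_top_of_nonneg hq0 hAtop
  have hAq1 : 1 ≤ A ^ q := ENNReal.one_le_rpow hA1 (by linarith)
  -- `F ≤ a B + (F + B) / 4` with `a ≥ 1` gives `F ≤ 2 a B`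
  have habsorb : F ≤ 2 * A ^ q * B := by
    generalize A ^ q = a at hmain hAq hAq1
    clear_value F B
    lift F to NNReal using hFtop
    lift B to NNReal using hBtop
    lift a to NNReal using hAq
    have h4 : (4⁻¹ : ℝ≥0∞) = ((4⁻¹ : NNReal) : ℝ≥0∞) := by simp
    rw [h4] at hmain
    norm_cast at hmain hAq1 ⊢
    rw [← NNReal.coe_le_coe] at hmain hAq1 ⊢
    push_cast at hmain hAq1 ⊢
    nlinarith [B.2, mul_le_mul_of_nonneg_right hAq1 B.2]
  refine habsorb.trans ?_
  rw [ENNReal.mul_rpow_of_nonneg _ _ hq0]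
  gcongr
  calc (2 : ℝ≥0∞) = 2 ^ (1 : ℝ) := (ENNReal.rpow_one 2).symm
    _ ≤ 2 ^ q := ENNReal.rpow_le_rpow_of_exponent_le one_le_two hq

end Family

/-! ### The maximal inequality in `L^q` -/

theorem eLpNorm_const_add_sum_le {α ι : Type*} [MeasurableSpace α] {ν : Measure α}
    [IsProbabilityMeasure ν] {Q : ℝ≥0∞} (hQ : 1 ≤ Q) (hQ' : Q ≠ ∞) (s : Finset ι)
    {f : ι → α → ℝ} (hf : ∀ i, Measurable (f i)) (ε : NNReal) :
    eLpNorm ((fun _ => (ε : ℝ)) + ∑ i ∈ s, f i) Q ν ≤ ε + ∑ i ∈ s, eLpNorm (f i) Q ν := by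
  refine (eLpNorm_add_le aestronglyMeasurable_const
    (Finset.aestronglyMeasurable_sum s fun i _ => (hf i).aestronglyMeasurable) hQ).trans ?_
  refine add_le_add (le_of_eq ?_) (eLpNorm_sum_le (fun i _ => (hf i).aestronglyMeasurable) hQ)
  rw [eLpNorm_const' _ (one_pos.trans_le hQ).ne' hQ', measure_univ, ENNReal.one_rpow, mul_one,
    Real.enorm_of_nonneg ε.coe_nonneg, ENNReal.ofReal_coe_nnreal]

section Lq

variable {S : Type*} [MeasurableSpace S] {n r p : ℕ}

theorem measurable_iSup_maxKernel {s : ℕ} {f : Fin p → (Fin s → S) → ℝ}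
    (hf : ∀ j, Measurable (f j)) :
    Measurable fun x : Fin n → S => ⨆ j, maxKernel (f j) x := by
  refine Measurable.iSup fun j => ?_
  unfold maxKernel
  exact Measurable.iSup fun i =>
    continuous_abs.measurable.comp ((hf j).comp (by fun_prop))

theorem measurable_iSup_uStat {ψ : Fin p → (Fin r → S) → ℝ} (hψ : ∀ j, Measurable (ψ j)) :
    Measurable fun x : Fin n → S => ⨆ j, uStat (ψ j) x := by
  refine Measurable.iSup fun j => ?_
  unfold uStat
  exact Finset.measurable_sum _ fun i _ => (hψ j).comp (by fun_prop)

theorem eLpNorm_iSup_uStat_le_of_projEnvelope_le {P : Measure S} [IsProbabilityMeasure P]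
    (hp : 1 ≤ p) {q l : ℝ} (hq : 1 ≤ q) (hql : q ≤ l)
    (hpl : (p : ℝ) ≤ Real.exp l) {ψ : Fin p → (Fin r → S) → ℝ} (hψ : ∀ j, Measurable (ψ j))
    (hLp : ∀ j, MemLp (ψ j) (ENNReal.ofReal q) (Measure.pi fun _ : Fin r => P))
    (hsym : ∀ j, IsSymmetricKernel (ψ j)) (h0 : ∀ j x, 0 ≤ ψ j x) {ε : ℝ≥0∞} (hε : ε ≠ 0)
    (hε' : ε ≠ ∞) {D : (Fin n → S) → ℝ}
    (hD : ∀ j x, projEnvelope P (ψ j) (ENNReal.ofReal l) ε Finset.univ x ≤ ‖D x‖ₑ) :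
    eLpNorm (fun x : Fin n → S => ⨆ j, uStat (ψ j) x) (ENNReal.ofReal q)
        (Measure.pi fun _ => P) ≤
      (2 * (12 * ((4 * r + 1) ^ r) ^ 2 : ℕ) : ℝ≥0∞) *
        eLpNorm D (ENNReal.ofReal q) (Measure.pi fun _ => P) := by
  have hq0 : 0 < q := by linarith
  have hQ0 : ENNReal.ofReal q ≠ 0 := by
    rw [Ne, ENNReal.ofReal_eq_zero, not_le]; exact hq0
  rw [eLpNorm_eq_lintegral_rpow_enorm_toReal hQ0 ENNReal.ofReal_ne_top,
    eLpNorm_eq_lintegral_rpow_enorm_toReal hQ0 ENNReal.ofReal_ne_top,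
    ENNReal.toReal_ofReal hq0.le]
  have : Nonempty (Fin p) := ⟨⟨0, hp⟩⟩
  have hle : ∀ x : Fin n → S,
      ‖⨆ j, uStat (ψ j) x‖ₑ ≤ ⨆ j, ENNReal.ofReal (uStat (ψ j) x) := by
    intro x
    obtain ⟨j, hj⟩ := exists_eq_ciSup_of_finite (f := fun j => uStat (ψ j) x)
    rw [← hj, Real.enorm_of_nonneg (uStat_nonneg (h0 j) x)]
    exact le_iSup (fun j => ENNReal.ofReal (uStat (ψ j) x)) j
  calc (∫⁻ x : Fin n → S, ‖⨆ j, uStat (ψ j) x‖ₑ ^ q ∂(Measure.pi fun _ => P)) ^ (1 / q)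
      ≤ ((2 * (12 * ((4 * r + 1) ^ r) ^ 2 : ℕ) : ℝ≥0∞) ^ q *
          ∫⁻ x, ‖D x‖ₑ ^ q ∂(Measure.pi fun _ => P)) ^ (1 / q) := by
        refine ENNReal.rpow_le_rpow ((lintegral_mono fun x => ?_).trans
          (lintegral_iSup_uStat_rpow_le hq hql hpl hψ hLp hsym h0 hε hε' hD)) (by positivity)
        exact ENNReal.rpow_le_rpow (hle x) hq0.le
    _ = _ := by
        rw [ENNReal.mul_rpow_of_nonneg _ _ (by positivity), ← ENNReal.rpow_mul,
          mul_one_div_cancel hq0.ne', ENNReal.rpow_one]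

/-- The maximal inequality on the canonical product space. -/
theorem eLpNorm_iSup_uStat_le (P : Measure S) [IsProbabilityMeasure P]
    (hp : 1 ≤ p) {q l : ℝ} (hq : 1 ≤ q) (hql : q ≤ l)
    (hpl : (p : ℝ) ≤ Real.exp l) {ψ : Fin p → (Fin r → S) → ℝ} (hψ : ∀ j, Measurable (ψ j))
    (hLp : ∀ j, MemLp (ψ j) (ENNReal.ofReal q) (Measure.pi fun _ : Fin r => P))
    (hsym : ∀ j, IsSymmetricKernel (ψ j)) (h0 : ∀ j x, 0 ≤ ψ j x) :
    eLpNorm (fun x : Fin n → S => ⨆ j, uStat (ψ j) x) (ENNReal.ofReal q)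
        (Measure.pi fun _ => P) ≤
      (2 * (12 * ((4 * r + 1) ^ r) ^ 2 : ℕ) : ℝ≥0∞) * ((r + 1 : ℕ) *
        ⨆ s : Fin (r + 1), (n : ℝ≥0∞) ^ (r - (s : ℕ)) * ENNReal.ofReal l ^ (s : ℕ) *
          eLpNorm (fun x : Fin n → S => ⨆ j, maxKernel (projKernel P (s : ℕ) (ψ j)) x)
            (ENNReal.ofReal q) (Measure.pi fun _ => P)) := by
  have hl : 0 ≤ l := by linarith
  have hQ1 : 1 ≤ ENNReal.ofReal q := by
    rw [← ENNReal.ofReal_one]; exact ENNReal.ofReal_le_ofReal hq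
  set ν : Measure (Fin n → S) := Measure.pi fun _ => P
  let m : ℕ → (Fin n → S) → ℝ := fun s x => ⨆ j, maxKernel (projKernel P s (ψ j)) x
  have hmm : ∀ s, Measurable (m s) := fun s =>
    measurable_iSup_maxKernel fun j => measurable_projKernel P (hψ j) s
  have hmax0 : ∀ (s : ℕ) (j : Fin p) (x : Fin n → S),
      0 ≤ maxKernel (projKernel P s (ψ j)) x :=
    fun s j x => Real.iSup_nonneg fun _ => abs_nonneg _
  have hm0 : ∀ s x, 0 ≤ m s x := fun s x => Real.iSup_nonneg fun j => hmax0 s j x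
  set T : ℝ≥0∞ := ⨆ s : Fin (r + 1), (n : ℝ≥0∞) ^ (r - (s : ℕ)) * ENNReal.ofReal l ^ (s : ℕ) *
    eLpNorm (m s) (ENNReal.ofReal q) ν
  set C : ℝ≥0∞ := 2 * (12 * ((4 * r + 1) ^ r) ^ 2 : ℕ)
  have hC : C ≠ ∞ := ENNReal.mul_ne_top (by simp) (ENNReal.natCast_ne_top _)
  have hmain : ∀ ε : NNReal, 0 < ε →
      eLpNorm (fun x : Fin n → S => ⨆ j, uStat (ψ j) x) (ENNReal.ofReal q) ν ≤
        C * (ε + (r + 1 : ℕ) * T) := by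
    intro ε hε
    let f : ℕ → (Fin n → S) → ℝ := fun s => ((n : ℝ) ^ (r - s) * l ^ s) • m s
    have hf0 : ∀ s x, 0 ≤ f s x := fun s x =>
      mul_nonneg (mul_nonneg (by positivity) (by positivity)) (hm0 s x)
    have hfm : ∀ s, Measurable (f s) := fun s => (hmm s).const_smul _
    let D : (Fin n → S) → ℝ := (fun _ => (ε : ℝ)) + ∑ s ∈ Finset.range (r + 1), f s
    have hD : ∀ j x, projEnvelope P (ψ j) (ENNReal.ofReal l) ε Finset.univ x ≤ ‖D x‖ₑ := by
      intro j x
      have hsum0 : 0 ≤ ∑ s ∈ Finset.range (r + 1), f s x :=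
        Finset.sum_nonneg fun s _ => hf0 s x
      simp only [D, Pi.add_apply, Finset.sum_apply]
      rw [Real.enorm_of_nonneg (add_nonneg ε.coe_nonneg hsum0), ENNReal.ofReal_add ε.coe_nonneg hsum0,
        ENNReal.ofReal_coe_nnreal, ENNReal.ofReal_sum_of_nonneg fun s _ => hf0 s x]
      refine (projEnvelope_le x).trans (add_le_add_right (Finset.sum_le_sum fun s _ => ?_) _)
      simp only [f, Pi.smul_apply, smul_eq_mul]
      rw [ENNReal.ofReal_mul (by positivity), ENNReal.ofReal_mul (by positivity),
        ENNReal.ofReal_pow (by positivity), ENNReal.ofReal_pow hl, ENNReal.ofReal_natCast]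
      gcongr
      exact le_ciSup (f := fun j => maxKernel (projKernel P s (ψ j)) x)
        (Set.finite_range _).bddAbove j
    refine (eLpNorm_iSup_uStat_le_of_projEnvelope_le hp hq hql hpl hψ hLp hsym h0
      (by exact_mod_cast hε.ne') ENNReal.coe_ne_top hD).trans (mul_le_mul_right ?_ _)
    calc eLpNorm D (ENNReal.ofReal q) ν
        ≤ ε + ∑ s ∈ Finset.range (r + 1), eLpNorm (f s) (ENNReal.ofReal q) ν :=
          eLpNorm_const_add_sum_le hQ1 ENNReal.ofReal_ne_top _ (fun s => hfm s) ε
      _ ≤ ε + ∑ _s ∈ Finset.range (r + 1), T := by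
          gcongr with s hs
          rw [eLpNorm_const_smul, Real.enorm_of_nonneg (by positivity),
            ENNReal.ofReal_mul (by positivity), ENNReal.ofReal_pow (by positivity),
            ENNReal.ofReal_pow hl, ENNReal.ofReal_natCast]
          exact le_iSup (fun s : Fin (r + 1) => (n : ℝ≥0∞) ^ (r - (s : ℕ)) *
            ENNReal.ofReal l ^ (s : ℕ) * eLpNorm (m s) (ENNReal.ofReal q) ν)
            ⟨s, Finset.mem_range.1 hs⟩
      _ = ε + (r + 1 : ℕ) * T := by
          rw [Finset.sum_const, Finset.card_range, nsmul_eq_mul]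
  have hlim : Filter.Tendsto (fun ε : ℝ≥0∞ => C * (ε + (r + 1 : ℕ) * T))
      (nhdsWithin 0 (Set.Ioi 0)) (nhds (C * (0 + (r + 1 : ℕ) * T))) := by
    refine ENNReal.Tendsto.const_mul (Filter.Tendsto.add_const _ ?_) (.inr hC)
    exact Filter.tendsto_id.mono_left nhdsWithin_le_nhds
  rw [zero_add] at hlim
  refine ge_of_tendsto hlim (eventually_nhdsWithin_of_forall fun ε hε => ?_)
  rcases eq_or_ne ε ∞ with rfl | hε'
  · refine le_trans (hmain 1 one_pos) ?_
    gcongr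
    exact le_top
  · lift ε to NNReal using hε'
    exact hmain ε (ENNReal.coe_pos.1 hε)

end Lq

theorem theorem5 (r : ℕ) :
    ∃ c : ℝ, 1 ≤ c ∧
      ∀ {Ω : Type*} [MeasurableSpace Ω] (μ : Measure Ω) [IsProbabilityMeasure μ]
        {S : Type*} [MeasurableSpace S] (P : Measure S) [IsProbabilityMeasure P]
        (n p : ℕ) (_ : 1 ≤ p) (q : ℝ) (_ : 1 ≤ q)
        (X : Fin n → Ω → S) (_ : ∀ i, Measurable (X i))
        (_ : ∀ i, μ.map (X i) = P) (_ : iIndepFun X μ)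
        (ψ : Fin p → (Fin r → S) → ℝ) (_ : ∀ j, Measurable (ψ j))
        (_ : ∀ j, MemLp (ψ j) (ENNReal.ofReal q) (Measure.pi fun _ : Fin r => P))
        (_ : ∀ j, IsSymmetricKernel (ψ j)) (_ : ∀ j x, 0 ≤ ψ j x),
        eLpNorm (fun ω => ⨆ j, uStat (ψ j) (fun i => X i ω)) (ENNReal.ofReal q) μ ≤
          ENNReal.ofReal c *
            ⨆ s : Fin (r + 1),
              (n : ℝ≥0∞) ^ (r - (s : ℕ)) * ENNReal.ofReal (q + Real.log p) ^ (s : ℕ) *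
                eLpNorm (fun ω => ⨆ j, maxKernel (projKernel P (s : ℕ) (ψ j)) (fun i => X i ω))
                  (ENNReal.ofReal q) μ := by
  refine ⟨((2 * (12 * ((4 * r + 1) ^ r) ^ 2) * (r + 1) : ℕ) : ℝ), ?_, ?_⟩
  · have : 1 ≤ 2 * (12 * ((4 * r + 1) ^ r) ^ 2) * (r + 1) := Nat.succ_le_of_lt (by positivity)
    exact_mod_cast this
  intro Ω _ μ _ S _ P _ n p hp q hq X hX hlaw hindep ψ hψ hLp hsym h0
  have hmp : MeasurePreserving (fun ω i => X i ω) μ (Measure.pi fun _ : Fin n => P) := by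
    refine ⟨measurable_pi_lambda _ hX, ?_⟩
    rw [(iIndepFun_iff_map_fun_eq_pi_map fun i => (hX i).aemeasurable).1 hindep]
    simp only [hlaw]
  have hp' : (0 : ℝ) < p := by exact_mod_cast hp
  have hlog : 0 ≤ Real.log p := Real.log_natCast_nonneg p
  have hpl : (p : ℝ) ≤ Real.exp (q + Real.log p) := by
    rw [Real.exp_add, Real.exp_log hp']
    exact le_mul_of_one_le_left hp'.le (Real.one_le_exp (by linarith))
  have h := eLpNorm_iSup_uStat_le (n := n) P hp hq (le_add_of_nonneg_right hlog) hpl hψ hLp hsym h0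
  rw [← eLpNorm_comp_measurePreserving
    (measurable_iSup_uStat hψ).aestronglyMeasurable hmp] at h
  have hs : ∀ s : Fin (r + 1),
      eLpNorm (fun x : Fin n → S => ⨆ j, maxKernel (projKernel P (s : ℕ) (ψ j)) x)
        (ENNReal.ofReal q) (Measure.pi fun _ => P) =
      eLpNorm (fun ω => ⨆ j, maxKernel (projKernel P (s : ℕ) (ψ j)) (fun i => X i ω))
        (ENNReal.ofReal q) μ := fun s =>
    (eLpNorm_comp_measurePreserving (measurable_iSup_maxKernel fun j =>
      measurable_projKernel P (hψ j) s).aestronglyMeasurable hmp).symm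
  simp only [hs] at h
  refine h.trans_eq ?_
  rw [ENNReal.ofReal_natCast, ← mul_assoc]
  push_cast
  rfl
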